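/- Let $p$ be a prime, let $K$ be a field of characteristic $p$ (for instance an algebraically closed one), let $h\ge 1$ be an integer and put $n=p^h$. In the polynomial ring $K[x_0,\dots,x_n,y_0,\dots,y_n]$ in $2n+2$ indeterminates, let $I_{n,n}$ be the ideal generated by the $2$-minors of the two-row matrix $$\left(\begin{array}{cccc|cccc} x_0&x_1&\cdots&x_{n-1}&y_0&y_1&\cdots&y_{n-1}\\ x_1&x_2&\cdots&x_n&y_1&y_2&\cdots&y_n\end{array}\right)$$ (the defining ideal of a rational normal scroll). For $1\le i\le n-1$ let $$F_i=\sum_{k=0}^{i}(-1)^k\binom{i}{k}x_{i+1}^{\,i-k}x_kx_i^{\,k},\qquad G_i=\sum_{k=0}^{i}(-1)^k\binom{i}{k}y_{i+1}^{\,i-k}y_ky_i^{\,k}.$$ Then $$I_{n,n}=\operatorname{Rad}\bigl(F_1,\dots,F_{n-1},\,G_1,\dots,G_{n-1},\,x_0y_n-x_ny_0\bigr).$$ In particular, $I_{n,n}$ is a set-theoretic complete intersection on these $2n-1$ polynomials: they generate $I_{n,n}$ up to radical, and their number $2n-1$ equals the height of $I_{n,n}$. -/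

import Mathlib

namespace Scroll

/-- The ideal generated by the 2-minors of a two-row matrix. The pairs `j = k` contribute only `0`,
and exchanging `j` and `k` only changes a sign. -/
def twoMinorsIdeal {R : Type*} [CommRing R] {ι : Type*} (A : Matrix (Fin 2) ι R) : Ideal R :=
  Ideal.span {m | ∃ j k : ι, m = (A.submatrix id ![j, k]).det}

/-- The two-row matrix with the two catalecticant blocks
`x₀ … x_{c-1} | y₀ … y_{d-1}` (first row) and `x₁ … x_c | y₁ … y_d` (second row). -/
def scrollMatrix {R : Type*} {c d : ℕ} (x : Fin (c + 1) → R) (y : Fin (d + 1) → R) :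
    Matrix (Fin 2) (Fin c ⊕ Fin d) R :=
  Matrix.of ![Sum.elim (fun j => x j.castSucc) (fun j => y j.castSucc),
    Sum.elim (fun j => x j.succ) (fun j => y j.succ)]

/-- The indeterminates `x₀, …, x_c` of the polynomial ring `K[x₀, …, x_c, y₀, …, y_d]`. -/
noncomputable def varX (K : Type*) [Field K] (c d : ℕ) (i : Fin (c + 1)) :
    MvPolynomial (Fin (c + 1) ⊕ Fin (d + 1)) K :=
  MvPolynomial.X (Sum.inl i)

/-- The indeterminates `y₀, …, y_d` of the polynomial ring `K[x₀, …, x_c, y₀, …, y_d]`. -/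
noncomputable def varY (K : Type*) [Field K] (c d : ℕ) (j : Fin (d + 1)) :
    MvPolynomial (Fin (c + 1) ⊕ Fin (d + 1)) K :=
  MvPolynomial.X (Sum.inr j)

/-- The ideal `I_{c,d}` of `K[x₀, …, x_c, y₀, …, y_d]` generated by the 2-minors of the generic
two-block matrix, i.e. the defining ideal of a rational normal scroll. -/
noncomputable def scrollIdeal (K : Type*) [Field K] (c d : ℕ) :
    Ideal (MvPolynomial (Fin (c + 1) ⊕ Fin (d + 1)) K) :=
  twoMinorsIdeal (scrollMatrix (varX K c d) (varY K c d))

/-- Verdi's polynomial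
`∑_{k=0}^{i} (-1)^k (i choose k) x_{i+1}^{i-k} x_k x_i^k` in `x₀, …, x_c`, for `i + 1 ≤ c`. -/
def verdi {R : Type*} [CommRing R] {c : ℕ} (x : Fin (c + 1) → R) (i : ℕ) (hi : i < c) : R :=
  ∑ k : Fin (i + 1), (-1) ^ (k : ℕ) * (i.choose k : R) * x ⟨i + 1, by omega⟩ ^ (i - (k : ℕ)) *
    x ⟨k, by omega⟩ * x ⟨i, by omega⟩ ^ (k : ℕ)

/-- The `2 n - 1` polynomials
`F_1, …, F_{n-1}, G_1, …, G_{n-1}, x₀ y_n - x_n y₀` of `K[x₀, …, x_n, y₀, …, y_n]`,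
where `F_i` and `G_i` are Verdi's polynomials in the `x` and in the `y`; the index `i : Fin (n - 1)`
starts from `0`, whence the shift by one. -/
noncomputable def gens (K : Type*) [Field K] (n : ℕ) :
    Fin (n - 1) ⊕ Fin (n - 1) ⊕ Unit → MvPolynomial (Fin (n + 1) ⊕ Fin (n + 1)) K
  | Sum.inl i => verdi (varX K n n) (i + 1) (by omega)
  | Sum.inr (Sum.inl i) => verdi (varY K n n) (i + 1) (by omega)
  | Sum.inr (Sum.inr _) =>
      varX K n n 0 * varY K n n (Fin.last n) - varX K n n (Fin.last n) * varY K n n 0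

/-- `I` is a set-theoretic complete intersection on the finite family `P`: the members of `P`
generate `I` up to radical, and their number is the height of `I`. -/
def IsSetTheoreticCompleteIntersectionOn {R : Type*} [CommRing R] (I : Ideal R)
    {ι : Type*} [Fintype ι] (P : ι → R) : Prop :=
  (Ideal.span (Set.range P)).radical = I.radical ∧ (Fintype.card ι : ℕ∞) = I.height

end Scroll

/-! Verdi's polynomials are binomial expansions: if `x_k = u t^k` for `k ≤ i`, then `F_i = u
(x_{i+1} - u t^{i+1})^i` (`verdi_geometric`). So a zero of all `F_i` over a field is a multiple of a
point `(1, t, …, t^n)`, or only its last coordinate can be nonzero. For two geometric sequences with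
ratios `t` and `s`, the last generator is `u v (s^n - t^n) = u v (s - t)^n`, because `n` is a power
of the characteristic; hence `s = t`, and the minors vanish (`minors_eq_zero`). Applied in the
fraction field of the quotient by each prime containing the generators, this puts the minors in the
radical.

Conversely, the scroll ideal is the kernel of `x_i ↦ x_0 t^i`, `y_i ↦ y_0 t^i`, since monomials with
the same image are congruent modulo the minors. It is therefore prime, and it contains the
generators.

Krull's height theorem bounds the height above by `2n - 1`. A strict chain of toric primes,
substituting for one more variable at a time, bounds it below. -/

namespace Scroll

open MvPolynomial

/-! ### Products of entries modulo the minors -/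

/-- Raising the index of one factor by `d` at the expense of the others. -/
lemma exists_shift {A : Type*} [CommRing A] {n : ℕ} {f : Bool → ℕ → A}
    (hf : ∀ b c i k, i < n → k < n → f b i * f c (k + 1) = f b (i + 1) * f c k) (b : Bool) :
    ∀ (d i : ℕ) (M : Multiset (Bool × ℕ)), (∀ z ∈ M, z.2 ≤ n) → i + d ≤ n →
      d ≤ (M.map Prod.snd).sum →
      ∃ M' : Multiset (Bool × ℕ), (∀ z ∈ M', z.2 ≤ n) ∧ M'.map Prod.fst = M.map Prod.fst ∧
        (M'.map Prod.snd).sum + d = (M.map Prod.snd).sum ∧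
        f b i * (M.map fun z => f z.1 z.2).prod =
          f b (i + d) * (M'.map fun z => f z.1 z.2).prod
  | 0, _, M, hM, _, _ => ⟨M, hM, rfl, rfl, rfl⟩
  | d + 1, i, M, hM, hi, hd => by
    -- The remaining weight is positive, so some factor can give up one unit of index.
    obtain ⟨z, hz, hz0⟩ : ∃ z ∈ M, z.2 ≠ 0 := by
      by_contra! hcon
      have : (M.map Prod.snd).sum = 0 := Multiset.sum_eq_zero fun k hk => by
        obtain ⟨z, hz, rfl⟩ := Multiset.mem_map.1 hk
        exact hcon z hz
      omega
    obtain ⟨M, rfl⟩ := Multiset.exists_cons_of_mem hz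
    obtain ⟨c, k⟩ := z
    obtain ⟨k, rfl⟩ := Nat.exists_eq_succ_of_ne_zero hz0
    have hk : k + 1 ≤ n := hM _ hz
    simp only [Multiset.map_cons, Multiset.sum_cons] at hd
    obtain ⟨M', h1, h2, h3, h4⟩ := exists_shift hf b d (i + 1) ((c, k) ::ₘ M)
      (by
        intro w hw
        rcases Multiset.mem_cons.1 hw with rfl | hw
        · exact (Nat.le_succ k).trans hk
        · exact hM _ (Multiset.mem_cons_of_mem hw)) (by omega)
      (by simp only [Multiset.map_cons, Multiset.sum_cons]; omega)
    refine ⟨M', h1, by simpa using h2, ?_, ?_⟩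
    · simp only [Multiset.map_cons, Multiset.sum_cons] at h3 ⊢
      omega
    · rw [show i + (d + 1) = i + 1 + d by omega, ← h4]
      simp only [Multiset.map_cons, Multiset.prod_cons]
      rw [← mul_assoc, ← mul_assoc, hf b c i k (by omega) (by omega)]

/-- Modulo the minors, a monomial is determined by its bidegree and its weight. -/
lemma prod_eq_of_weight_eq {A : Type*} [CommRing A] {n : ℕ} {f : Bool → ℕ → A}
    (hf : ∀ b c i k, i < n → k < n → f b i * f c (k + 1) = f b (i + 1) * f c k) :
    ∀ (N : ℕ) (s s' : Multiset (Bool × ℕ)), s.card = N → (∀ z ∈ s, z.2 ≤ n) →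
      (∀ z ∈ s', z.2 ≤ n) → s.map Prod.fst = s'.map Prod.fst →
      (s.map Prod.snd).sum = (s'.map Prod.snd).sum →
      (s.map fun z => f z.1 z.2).prod = (s'.map fun z => f z.1 z.2).prod
  | 0, s, s', hN, _, _, h1, _ => by
    have hs : s = 0 := Multiset.card_eq_zero.1 hN
    subst hs
    have : s' = 0 := by simpa [eq_comm] using h1
    rw [this]
  | N + 1, s, s', hN, hs, hs', h1, h2 => by
    obtain ⟨⟨b, i⟩, s, rfl, hc⟩ := Multiset.card_eq_succ_iff.1 hN
    have hb : b ∈ s'.map Prod.fst := by rw [← h1]; simp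
    obtain ⟨⟨b', j⟩, hz, rfl⟩ := Multiset.mem_map.1 hb
    obtain ⟨s', rfl⟩ := Multiset.exists_cons_of_mem hz
    have hi : i ≤ n := hs (b', i) (by simp)
    have hj : j ≤ n := hs' (b', j) (by simp)
    replace hs : ∀ z ∈ s, z.2 ≤ n := fun z hz => hs z (Multiset.mem_cons_of_mem hz)
    replace hs' : ∀ z ∈ s', z.2 ≤ n := fun z hz => hs' z (Multiset.mem_cons_of_mem hz)
    simp only [Multiset.map_cons, Multiset.sum_cons, Multiset.prod_cons,
      Multiset.cons_inj_right] at h1 h2 ⊢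
    rcases le_total i j with hij | hij
    · obtain ⟨t, ht1, ht2, ht3, ht4⟩ := exists_shift hf b' (j - i) i s hs (by omega) (by omega)
      rw [ht4, Nat.add_sub_cancel' hij, prod_eq_of_weight_eq hf N t s' _ ht1 hs' (ht2.trans h1)
        (by omega)]
      rw [← Multiset.card_map Prod.fst, ht2, Multiset.card_map, hc]
    · obtain ⟨t, ht1, ht2, ht3, ht4⟩ := exists_shift hf b' (i - j) j s' hs' (by omega) (by omega)
      rw [ht4, Nat.add_sub_cancel' hij, prod_eq_of_weight_eq hf N s t hc hs ht1 (h1.trans ht2.symm)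
        (by omega)]

/-- The kernel of a monomial homomorphism is contained in every ideal which identifies any two
monomials with the same image. -/
lemma ker_le_of_monomial {K σ τ : Type*} [Field K] (φ : MvPolynomial σ K →ₐ[K] MvPolynomial τ K)
    (E : (σ →₀ ℕ) → (τ →₀ ℕ)) (hE : ∀ m, φ (monomial m 1) = monomial (E m) 1)
    (I : Ideal (MvPolynomial σ K))
    (hI : ∀ m m', E m = E m' → Ideal.Quotient.mk I (monomial m 1) =
      Ideal.Quotient.mk I (monomial m' 1)) : RingHom.ker φ ≤ I := by
  classical
  -- A linear map through which the quotient map factors: an image monomial goes to the class of any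
  -- preimage, which `hI` makes independent of the choice. Other monomials may go anywhere.
  let ψ : MvPolynomial τ K →ₗ[K] (MvPolynomial σ K ⧸ I) := (basisMonomials τ K).constr K
    fun d => if h : ∃ m, E m = d then Ideal.Quotient.mk I (monomial h.choose 1) else 0
  have key : ψ ∘ₗ φ.toLinearMap = (Ideal.Quotient.mkₐ K I).toLinearMap := by
    refine (basisMonomials σ K).ext fun m => ?_
    have hex : ∃ m', E m' = E m := ⟨m, rfl⟩
    have h1 : ψ (monomial (E m) 1) = Ideal.Quotient.mk I (monomial hex.choose 1) := by
      have := (basisMonomials τ K).constr_basis K (fun d => if h : ∃ m, E m = d then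
        Ideal.Quotient.mk I (monomial h.choose 1) else 0) (E m)
      rw [coe_basisMonomials] at this
      rw [dif_pos hex] at this
      exact this
    simp only [coe_basisMonomials, LinearMap.comp_apply, AlgHom.toLinearMap_apply, hE, h1]
    exact hI _ _ hex.choose_spec
  intro x hx
  have := LinearMap.congr_fun key x
  rw [LinearMap.comp_apply, AlgHom.toLinearMap_apply, (RingHom.mem_ker).1 hx, map_zero] at this
  exact Ideal.Quotient.eq_zero_iff_mem.1 this.symm

/-! ### Zeros of Verdi's polynomials -/

/-- Here `x_k x_i^k = u t^k (u t^i)^k = u (u t^{i+1})^k`, so the sum is a binomial expansion. -/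
lemma verdi_geometric {R : Type*} [CommRing R] {c : ℕ} (x : Fin (c + 1) → R) (u t : R) {i : ℕ}
    (hi : i < c) (hx : ∀ k : Fin (c + 1), (k : ℕ) ≤ i → x k = u * t ^ (k : ℕ)) :
    verdi x i hi = u * (x ⟨i + 1, by omega⟩ - u * t ^ (i + 1)) ^ i := by
  rw [verdi, sub_eq_neg_add, add_pow, Finset.mul_sum, Finset.sum_fin_eq_sum_range]
  refine Finset.sum_congr rfl fun k hk => ?_
  have hk : k < i + 1 := Finset.mem_range.1 hk
  rw [dif_pos hk, hx ⟨k, by omega⟩ (by simpa using Nat.lt_succ_iff.1 hk), hx ⟨i, by omega⟩ le_rfl,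
    neg_pow]
  ring

/-- A common zero of Verdi's polynomials is proportional to a point of the rational normal curve
outside the last coordinate point, or to the last coordinate point. -/
lemma geometric_or_eq_zero_of_verdi {L : Type*} [Field L] {c : ℕ} (hc : 0 < c)
    (x : Fin (c + 1) → L) (hx : ∀ i (hi : i < c), 0 < i → verdi x i hi = 0) :
    (∃ u t, u ≠ 0 ∧ ∀ k : Fin (c + 1), x k = u * t ^ (k : ℕ)) ∨
      ∀ k : Fin (c + 1), (k : ℕ) < c → x k = 0 := by
  by_cases h0 : x 0 = 0
  · right
    suffices ∀ m, m < c → ∀ k : Fin (c + 1), (k : ℕ) ≤ m → x k = 0 from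
      fun k hk => this k hk k le_rfl
    intro m
    induction m with
    | zero =>
      intro _ k hk
      rwa [show k = 0 from Fin.ext (by simpa using hk)]
    | succ m ih =>
      intro hm k hk
      rcases hk.lt_or_eq with hk | hk
      · exact ih (by omega) k (by omega)
      -- Once `x_0, …, x_m` vanish, only the last term `± x_{m+1}^{m+2}` of the sum survives.
      · have := hx (m + 1) hm (by omega)
        rw [verdi, Fin.sum_univ_castSucc, Finset.sum_eq_zero, zero_add] at this
        · have hxk : x ⟨m + 1, by omega⟩ = x k := by congr 1; exact Fin.ext hk.symm
          simp only [Fin.val_last, Nat.choose_self, Nat.cast_one, mul_one, Nat.sub_self, pow_zero,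
            hxk] at this
          simpa using this
        · intro j _
          have hj : x ⟨j, by omega⟩ = 0 := ih (by omega) _ (Nat.lt_succ_iff.1 j.2)
          simp [hj]
  · left
    refine ⟨x 0, x 1 / x 0, h0, ?_⟩
    suffices ∀ m, 0 < m → m ≤ c → ∀ k : Fin (c + 1), (k : ℕ) ≤ m →
      x k = x 0 * (x 1 / x 0) ^ (k : ℕ) from fun k => this c hc le_rfl k (by omega)
    intro m hm
    induction m, hm using Nat.le_induction with
    | base =>
      intro _ k hk
      rcases Nat.le_one_iff_eq_zero_or_eq_one.1 hk with hk | hk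
      · rw [show k = 0 from Fin.ext hk]; simp
      · rw [show k = 1 from Fin.ext (by rw [hk, Fin.val_one', Nat.mod_eq_of_lt (by omega)])]
        rw [Fin.val_one', Nat.mod_eq_of_lt (by omega)]
        field_simp
    | succ m hm ih =>
      intro hmc k hk
      rcases hk.lt_or_eq with hk | hk
      · exact ih (by omega) k (by omega)
      · have := hx m (by omega) hm
        rw [verdi_geometric x _ _ _ (ih (by omega))] at this
        have h2 := eq_zero_of_pow_eq_zero ((mul_eq_zero.1 this).resolve_left h0)
        rw [hk, ← sub_eq_zero.1 h2]
        congr 1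
        exact Fin.ext hk

/-- In characteristic `p`, the minors vanish at every common zero of `F_i`, `G_i` and
`x₀ y_n - x_n y₀`, for `n` a power of `p`. -/
lemma minors_eq_zero {L : Type*} [Field L] (p : ℕ) [Fact p.Prime] [CharP L p] (h : ℕ)
    (x y : Fin (p ^ h + 1) → L)
    (hx : ∀ i (hi : i < p ^ h), 0 < i → verdi x i hi = 0)
    (hy : ∀ i (hi : i < p ^ h), 0 < i → verdi y i hi = 0)
    (hxy : x 0 * y (Fin.last _) - x (Fin.last _) * y 0 = 0) (j k : Fin (p ^ h) ⊕ Fin (p ^ h)) :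
    scrollMatrix x y 0 j * scrollMatrix x y 1 k = scrollMatrix x y 0 k * scrollMatrix x y 1 j := by
  have hn : 0 < p ^ h := pow_pos (Fact.out : p.Prime).pos h
  have mixed : ∀ (x y : Fin (p ^ h + 1) → L) (u t : L), u ≠ 0 →
      (∀ k : Fin (p ^ h + 1), x k = u * t ^ (k : ℕ)) →
      (∀ k : Fin (p ^ h + 1), (k : ℕ) < p ^ h → y k = 0) →
      x 0 * y (Fin.last _) - x (Fin.last _) * y 0 = 0 → y = 0 := by
    intro x y u t hu hx hy hxy
    funext k
    rcases (Nat.lt_succ_iff.1 k.2).lt_or_eq with hk | hk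
    · exact hy k hk
    · rw [show k = Fin.last _ from Fin.ext hk]
      rw [hy 0 (by simpa using hn), hx 0] at hxy
      simpa [hu] using hxy
  rcases geometric_or_eq_zero_of_verdi hn x hx with ⟨u, t, hu, hx'⟩ | hx' <;>
  rcases geometric_or_eq_zero_of_verdi hn y hy with ⟨v, s, hv, hy'⟩ | hy'
  · have hst : s = t := by
      have : s ^ p ^ h = t ^ p ^ h := by
        rw [hx', hy', hx', hy'] at hxy
        simp only [Fin.val_zero, pow_zero, mul_one, Fin.val_last] at hxy
        have : u * v * (s ^ p ^ h - t ^ p ^ h) = 0 := by linear_combination hxy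
        exact sub_eq_zero.1 ((mul_eq_zero.1 this).resolve_left (mul_ne_zero hu hv))
      -- Frobenius: this is where the characteristic and the shape of `n` enter.
      rw [← sub_eq_zero, ← sub_pow_char_pow] at this
      exact sub_eq_zero.1 (eq_zero_of_pow_eq_zero this)
    subst hst
    rcases j with j | j <;> rcases k with k | k <;> simp [scrollMatrix, hx', hy'] <;> ring
  · have hy0 := mixed x y u t hu hx' hy' hxy
    rcases j with j | j <;> rcases k with k | k <;> simp [scrollMatrix, hx', hy0]
    all_goals ring
  · have hx0 := mixed y x v s hv hy' hx' (by linear_combination -hxy)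
    rcases j with j | j <;> rcases k with k | k <;> simp [scrollMatrix, hx0, hy']
    all_goals ring
  · have hx0 : ∀ j : Fin (p ^ h), x j.castSucc = 0 := fun j => hx' _ (by simp)
    have hy0 : ∀ j : Fin (p ^ h), y j.castSucc = 0 := fun j => hy' _ (by simp)
    rcases j with j | j <;> rcases k with k | k <;> simp [scrollMatrix, hx0, hy0]

/-! ### A chain of toric primes -/

section Toric

variable (K : Type*) [Field K] (n : ℕ)

/-- The index `i` of `x_i` or `y_i`. -/
def idx : Fin (n + 1) ⊕ Fin (n + 1) → ℕ := Sum.elim (↑) (↑)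

/-- The variable `x₀` for `x_i` and `y₀` for `y_i`. -/
def base : Fin (n + 1) ⊕ Fin (n + 1) → Fin (n + 1) ⊕ Fin (n + 1) :=
  Sum.elim (fun _ => Sum.inl 0) (fun _ => Sum.inr 0)

open Classical in
/-- The substitution `x_i ↦ x₀ t^i`, `y_i ↦ y₀ t^i` on the variables of `S`, the other variables
being kept. -/
noncomputable def toricHom (S : Set (Fin (n + 1) ⊕ Fin (n + 1))) :
    MvPolynomial (Fin (n + 1) ⊕ Fin (n + 1)) K →ₐ[K]
      MvPolynomial (Option (Fin (n + 1) ⊕ Fin (n + 1))) K :=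
  aeval fun z => if z ∈ S then X (some (base n z)) * X none ^ idx n z else X (some z)

variable {K n}

lemma base_base (z : Fin (n + 1) ⊕ Fin (n + 1)) : base n (base n z) = base n z := by
  rcases z with z | z <;> rfl

lemma idx_base (z : Fin (n + 1) ⊕ Fin (n + 1)) : idx n (base n z) = 0 := by
  rcases z with z | z <;> rfl

lemma toricHom_X_of_mem {S : Set (Fin (n + 1) ⊕ Fin (n + 1))} {z} (hz : z ∈ S) :
    toricHom K n S (X z) = X (some (base n z)) * X none ^ idx n z := by
  simp [toricHom, hz]

lemma toricHom_X_of_notMem {S : Set (Fin (n + 1) ⊕ Fin (n + 1))} {z} (hz : z ∉ S) :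
    toricHom K n S (X z) = X (some z) := by
  simp [toricHom, hz]

lemma toricHom_X_base (S : Set (Fin (n + 1) ⊕ Fin (n + 1))) (z) :
    toricHom K n S (X (base n z)) = X (some (base n z)) := by
  by_cases hz : base n z ∈ S
  · rw [toricHom_X_of_mem hz, base_base, idx_base, pow_zero, mul_one]
  · exact toricHom_X_of_notMem hz

instance (S : Set (Fin (n + 1) ⊕ Fin (n + 1))) : (RingHom.ker (toricHom K n S)).IsPrime :=
  RingHom.ker_isPrime _

/-- The larger substitution factors through the smaller one, followed by the substitution `ρ` for
`z` alone. If `z` is `x_0` or `y_0` the two homomorphisms coincide; otherwise `ρ` fixes all base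
variables. -/
lemma ker_toricHom_le_insert (S : Set (Fin (n + 1) ⊕ Fin (n + 1))) (z) :
    RingHom.ker (toricHom K n S) ≤ RingHom.ker (toricHom K n (insert z S)) := by
  classical
  by_cases h0 : z = base n z
  · have : toricHom K n (insert z S) = toricHom K n S := by
      refine MvPolynomial.algHom_ext fun w => ?_
      by_cases hw : w = z
      · rw [hw, h0, toricHom_X_base, toricHom_X_base]
      · by_cases hS : w ∈ S
        · rw [toricHom_X_of_mem (Set.mem_insert_of_mem z hS), toricHom_X_of_mem hS]
        · rw [toricHom_X_of_notMem (by simp [hw, hS]), toricHom_X_of_notMem hS]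
    rw [this]
  let ρ : MvPolynomial (Option (Fin (n + 1) ⊕ Fin (n + 1))) K →ₐ[K]
      MvPolynomial (Option (Fin (n + 1) ⊕ Fin (n + 1))) K :=
    aeval fun w => if w = some z then X (some (base n z)) * X none ^ idx n z else X w
  have hρ : ρ.comp (toricHom K n S) = toricHom K n (insert z S) := by
    refine MvPolynomial.algHom_ext fun w => ?_
    have hb : base n w ≠ z := fun h => h0 (by rw [← h, base_base])
    by_cases hS : w ∈ S
    · rw [AlgHom.comp_apply, toricHom_X_of_mem hS, toricHom_X_of_mem (Set.mem_insert_of_mem z hS)]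
      simp [ρ, hb]
    · by_cases hw : w = z
      · subst hw
        rw [AlgHom.comp_apply, toricHom_X_of_notMem hS, toricHom_X_of_mem (Set.mem_insert w S)]
        simp [ρ]
      · rw [AlgHom.comp_apply, toricHom_X_of_notMem hS, toricHom_X_of_notMem (by simp [hw, hS])]
        simp [ρ, hw]
  intro f hf
  rw [RingHom.mem_ker] at hf ⊢
  rw [← hρ, AlgHom.comp_apply, hf, map_zero]

/-- With `x_1 ↦ x_0 t` already substituted, the binomial `z x_0^i - x_1^i z_0`, where `i` is the
index of `z` and `z_0` its base variable, dies only after `z` is substituted too. -/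
lemma ker_toricHom_lt_insert (hn : 0 < n) {S : Set (Fin (n + 1) ⊕ Fin (n + 1))}
    (h1 : Sum.inl 1 ∈ S) {z} (hz : z ∉ S) (hz0 : 0 < idx n z) :
    RingHom.ker (toricHom K n S) < RingHom.ker (toricHom K n (insert z S)) := by
  have hi : idx n (Sum.inl 1) = 1 := by
    simp [idx, Nat.mod_eq_of_lt (by omega : 1 < n + 1)]
  have hx0 : base n (Sum.inl (1 : Fin (n + 1))) = Sum.inl 0 := rfl
  refine (ker_toricHom_le_insert S z).lt_of_not_ge fun hle => ?_
  have hmem : (X z * X (Sum.inl 0) ^ idx n z - X (Sum.inl 1) ^ idx n z * X (base n z) :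
      MvPolynomial (Fin (n + 1) ⊕ Fin (n + 1)) K) ∈
      RingHom.ker (toricHom K n (insert z S)) := by
    rw [RingHom.mem_ker, map_sub, map_mul, map_mul, map_pow, map_pow,
      toricHom_X_of_mem (Set.mem_insert z S), toricHom_X_of_mem (Set.mem_insert_of_mem z h1),
      toricHom_X_base, hi, ← hx0, toricHom_X_base]
    ring
  have := hle hmem
  rw [RingHom.mem_ker, map_sub, map_mul, map_mul, map_pow, map_pow,
    toricHom_X_of_notMem hz, toricHom_X_of_mem h1,
    toricHom_X_base, hi, ← hx0, toricHom_X_base] at this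
  classical
  have hb : base n z ≠ z := fun h => by rw [← h, idx_base] at hz0; exact lt_irrefl 0 hz0
  have hb1 : base n (Sum.inl 1) ≠ z := fun h => by rw [← h, idx_base] at hz0; exact lt_irrefl 0 hz0
  -- Setting `z = 0` and every other variable to `1` gives `-1 = 0`.
  have h2 := congrArg (aeval fun w => if w = some z then (0 : K) else 1) this
  simp [hb, hb1] at h2

lemma card_le_height_ker_toricHom (hn : 0 < n) (T : Finset (Fin (n + 1) ⊕ Fin (n + 1)))
    (hT : ∀ z ∈ T, z ≠ Sum.inl 1 ∧ 0 < idx n z) :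
    (T.card : ℕ∞) ≤ (RingHom.ker (toricHom K n (insert (Sum.inl 1) (T : Set _)))).height := by
  classical
  induction T using Finset.induction_on with
  | empty => simp
  | insert z T hz ih =>
    have hz' := hT z (Finset.mem_insert_self z T)
    have hlt := ker_toricHom_lt_insert (K := K) (z := z) hn (S := insert (Sum.inl 1) (T : Set _))
      (Set.mem_insert _ _) (by simp [hz, hz'.1]) hz'.2
    rw [Finset.card_insert_of_notMem hz, Finset.coe_insert, Set.insert_comm, Nat.cast_add,
      Nat.cast_one]
    exact (add_le_add_left (ih fun w hw => hT w (Finset.mem_insert_of_mem hw)) 1).trans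
      (Ideal.height_add_one_le_of_lt_of_isPrime hlt)

lemma ker_toricHom_mono {S : Set (Fin (n + 1) ⊕ Fin (n + 1))}
    (T : Finset (Fin (n + 1) ⊕ Fin (n + 1))) :
    RingHom.ker (toricHom K n S) ≤ RingHom.ker (toricHom K n (T ∪ S)) := by
  classical
  induction T using Finset.induction_on with
  | empty => simp
  | insert z T hz ih =>
    rw [Finset.coe_insert, Set.insert_union]
    exact ih.trans (ker_toricHom_le_insert _ z)

lemma le_height_ker_toricHom (hn : 0 < n) :
    ((2 * n - 1 : ℕ) : ℕ∞) ≤ (RingHom.ker (toricHom K n Set.univ)).height := by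
  classical
  -- The `2n` variables of positive index, without `x_1`, which is substituted at the start of the
  -- chain.
  let T : Finset (Fin (n + 1) ⊕ Fin (n + 1)) :=
    (Finset.univ.image (Sum.map Fin.succ Fin.succ : Fin n ⊕ Fin n → _)).erase (Sum.inl 1)
  have hcard : T.card = 2 * n - 1 := by
    have hinj : Function.Injective (Sum.map Fin.succ Fin.succ : Fin n ⊕ Fin n → _) :=
      (Fin.succ_injective n).sumMap (Fin.succ_injective n)
    rw [Finset.card_erase_of_mem, Finset.card_image_of_injective _ hinj]
    · simp; omega
    · refine Finset.mem_image.2 ⟨Sum.inl ⟨0, hn⟩, Finset.mem_univ _, ?_⟩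
      simp only [Sum.map_inl, Sum.inl.injEq]
      exact Fin.ext (by simp [Nat.mod_eq_of_lt (by omega : 1 < n + 1)])
  have h1 := card_le_height_ker_toricHom (K := K) hn T (by
    intro z hz
    obtain ⟨h1, h2⟩ := Finset.mem_erase.1 hz
    obtain ⟨w, -, rfl⟩ := Finset.mem_image.1 h2
    refine ⟨h1, ?_⟩
    rcases w with w | w <;> simp [idx])
  rw [hcard] at h1
  refine h1.trans (Ideal.height_mono ?_)
  have := ker_toricHom_mono (K := K) (n := n) (S := insert (Sum.inl 1) ↑T) Finset.univ
  rwa [Finset.coe_univ, Set.univ_union] at this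

end Toric

/-! ### The scroll ideal is a toric prime -/

section ScrollIdeal

variable {K : Type*} [Field K] {n : ℕ}

lemma det_submatrix_two {R ι : Type*} [CommRing R] (A : Matrix (Fin 2) ι R) (j k : ι) :
    (A.submatrix id ![j, k]).det = A 0 j * A 1 k - A 0 k * A 1 j := by
  simp [Matrix.det_fin_two]

lemma twoMinorsIdeal_le_iff {R ι : Type*} [CommRing R] {A : Matrix (Fin 2) ι R} {J : Ideal R} :
    twoMinorsIdeal A ≤ J ↔ ∀ j k, A 0 j * A 1 k - A 0 k * A 1 j ∈ J := by
  rw [twoMinorsIdeal, Ideal.span_le]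
  constructor
  · intro h j k
    exact h ⟨j, k, (det_submatrix_two A j k).symm⟩
  · rintro h _ ⟨j, k, rfl⟩
    rw [det_submatrix_two]
    exact h j k

lemma toricHom_univ_varX (k : Fin (n + 1)) :
    toricHom K n Set.univ (varX K n n k) = X (some (Sum.inl 0)) * X none ^ (k : ℕ) :=
  toricHom_X_of_mem (Set.mem_univ _)

lemma toricHom_univ_varY (k : Fin (n + 1)) :
    toricHom K n Set.univ (varY K n n k) = X (some (Sum.inr 0)) * X none ^ (k : ℕ) :=
  toricHom_X_of_mem (Set.mem_univ _)

lemma scrollIdeal_le_ker : scrollIdeal K n n ≤ RingHom.ker (toricHom K n Set.univ) := by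
  refine twoMinorsIdeal_le_iff.2 fun j k => ?_
  rw [RingHom.mem_ker]
  rcases j with j | j <;> rcases k with k | k <;>
    simp only [scrollMatrix, Matrix.of_apply, Matrix.cons_val_zero, Matrix.cons_val_one,
      Sum.elim_inl, Sum.elim_inr, map_sub, map_mul, toricHom_univ_varX, toricHom_univ_varY,
      Fin.val_castSucc, Fin.val_succ] <;> ring

open Finsupp in
/-- The exponent of the image of a variable under `toricHom K n univ`. -/
noncomputable def toricExponent (z : Fin (n + 1) ⊕ Fin (n + 1)) :
    Option (Fin (n + 1) ⊕ Fin (n + 1)) →₀ ℕ :=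
  single (some (base n z)) 1 + single none (idx n z)

lemma ringHom_monomial_one {R σ A : Type*} [CommSemiring R] [CommSemiring A]
    (φ : MvPolynomial σ R →+* A) (m : σ →₀ ℕ) :
    φ (monomial m 1) = (m.toMultiset.map fun z => φ (X z)).prod := by
  induction m using Finsupp.induction_linear with
  | zero => simp
  | add f g hf hg =>
    rw [← mul_one (1 : R), ← monomial_mul, map_mul, hf, hg, Finsupp.toMultiset_add,
      Multiset.map_add, Multiset.prod_add]
  | single z k =>
    rw [← X_pow_eq_monomial, map_pow, Finsupp.toMultiset_single, Multiset.map_nsmul,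
      Multiset.prod_nsmul, Multiset.map_singleton, Multiset.prod_singleton]

lemma toricHom_univ_monomial (m : (Fin (n + 1) ⊕ Fin (n + 1)) →₀ ℕ) :
    toricHom K n Set.univ (monomial m 1) =
      monomial (m.toMultiset.map toricExponent).sum 1 := by
  have h1 := ringHom_monomial_one (toricHom K n Set.univ).toRingHom m
  refine Eq.trans h1 ?_
  induction m.toMultiset using Multiset.induction_on with
  | empty => simp
  | cons z M ih =>
    rw [Multiset.map_cons, Multiset.prod_cons, ih, Multiset.map_cons, Multiset.sum_cons,
      ← mul_one (1 : K), ← monomial_mul, mul_one]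
    congr 1
    refine (toricHom_X_of_mem (Set.mem_univ z)).trans ?_
    rw [toricExponent, X_pow_eq_monomial, X, monomial_mul, mul_one]

/-- The exponents of `x_0`, `y_0` and `t` in the image record the bidegree and the weight. -/
lemma map_isLeft_eq_and_sum_idx_eq {M M' : Multiset (Fin (n + 1) ⊕ Fin (n + 1))}
    (h : (M.map toricExponent).sum = (M'.map toricExponent).sum) :
    M.map Sum.isLeft = M'.map Sum.isLeft ∧ (M.map (idx n)).sum = (M'.map (idx n)).sum := by
  have key : ∀ M : Multiset (Fin (n + 1) ⊕ Fin (n + 1)),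
      (M.map toricExponent).sum (some (Sum.inl 0)) = (M.map Sum.isLeft).count true ∧
      (M.map toricExponent).sum (some (Sum.inr 0)) = (M.map Sum.isLeft).count false ∧
      (M.map toricExponent).sum none = (M.map (idx n)).sum := by
    intro M
    induction M using Multiset.induction_on with
    | empty => simp
    | cons z M ih =>
      obtain ⟨h1, h2, h3⟩ := ih
      rcases z with z | z <;>
        simp [h1, h2, h3, toricExponent, base, add_comm]
  refine ⟨Multiset.ext.2 fun b => ?_, ?_⟩
  · cases b
    · rw [← (key M).2.1, ← (key M').2.1, h]
    · rw [← (key M).1, ← (key M').1, h]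
  · rw [← (key M).2.2, ← (key M').2.2, h]

lemma ker_le_scrollIdeal : RingHom.ker (toricHom K n Set.univ) ≤ scrollIdeal K n n := by
  classical
  refine ker_le_of_monomial _ _ toricHom_univ_monomial _ fun m m' hmm => ?_
  obtain ⟨h1, h2⟩ := map_isLeft_eq_and_sum_idx_eq hmm
  -- `true` stands for `x` and `false` for `y`; the value `0` beyond index `n` is never used.
  let f : Bool → ℕ → MvPolynomial (Fin (n + 1) ⊕ Fin (n + 1)) K ⧸ scrollIdeal K n n :=
    fun b i => if h : i ≤ n then
      Ideal.Quotient.mk _ (X (if b then Sum.inl ⟨i, by omega⟩ else Sum.inr ⟨i, by omega⟩)) else 0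
  have hf : ∀ b c i k, i < n → k < n → f b i * f c (k + 1) = f b (i + 1) * f c k := by
    intro b c i k hi hk
    let col : Bool → ∀ i, i < n → Fin n ⊕ Fin n := fun b i hi =>
      if b then Sum.inl ⟨i, hi⟩ else Sum.inr ⟨i, hi⟩
    have := twoMinorsIdeal_le_iff.1 (le_refl (scrollIdeal K n n)) (col b i hi) (col c k hk)
    rw [← Ideal.Quotient.eq, map_mul, map_mul] at this
    simp only [f, dif_pos hi.le, dif_pos hk.le, dif_pos (Nat.succ_le_iff.2 hi),
      dif_pos (Nat.succ_le_iff.2 hk)]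
    refine Eq.trans ?_ (mul_comm _ _)
    cases b <;> cases c <;> exact this
  have hfz : ∀ z, f z.isLeft (idx n z) = Ideal.Quotient.mk (scrollIdeal K n n) (X z) := by
    rintro (z | z) <;> simp [f, idx, Nat.lt_succ_iff.1 z.2]
  have hle : ∀ M : Multiset (Fin (n + 1) ⊕ Fin (n + 1)),
      ∀ w ∈ M.map (fun z => (z.isLeft, idx n z)), w.2 ≤ n := by
    intro M w hw
    obtain ⟨z, -, rfl⟩ := Multiset.mem_map.1 hw
    rcases z with z | z <;> exact Nat.lt_succ_iff.1 z.2
  have := prod_eq_of_weight_eq hf _ (m.toMultiset.map fun z => (z.isLeft, idx n z))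
    (m'.toMultiset.map fun z => (z.isLeft, idx n z)) rfl (hle _) (hle _)
    (by rw [Multiset.map_map, Multiset.map_map]; exact h1)
    (by rw [Multiset.map_map, Multiset.map_map]; exact h2)
  simp only [Multiset.map_map, Function.comp_def, hfz] at this
  rw [ringHom_monomial_one, ringHom_monomial_one, this]

lemma scrollIdeal_eq_ker : scrollIdeal K n n = RingHom.ker (toricHom K n Set.univ) :=
  scrollIdeal_le_ker.antisymm ker_le_scrollIdeal

lemma scrollIdeal_isPrime : (scrollIdeal K n n).IsPrime := by
  rw [scrollIdeal_eq_ker]; infer_instance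

lemma map_verdi {R S : Type*} [CommRing R] [CommRing S] (φ : R →+* S) {c : ℕ}
    (x : Fin (c + 1) → R) (i : ℕ) (hi : i < c) :
    φ (verdi x i hi) = verdi (fun k => φ (x k)) i hi := by
  simp [verdi]

lemma span_gens_le_scrollIdeal : Ideal.span (Set.range (gens K n)) ≤ scrollIdeal K n n := by
  rw [Ideal.span_le, scrollIdeal_eq_ker]
  have hv : ∀ i (hi : i < n), 0 < i → ∀ (x : Fin (n + 1) → _)
      (u t : MvPolynomial (Option (Fin (n + 1) ⊕ Fin (n + 1))) K),
      (∀ k, toricHom K n Set.univ (x k) = u * t ^ (k : ℕ)) →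
      toricHom K n Set.univ (verdi x i hi) = 0 := by
    intro i hi h0 x u t hx
    refine (map_verdi (toricHom K n Set.univ).toRingHom x i hi).trans ?_
    rw [verdi_geometric (fun k => (toricHom K n Set.univ).toRingHom (x k)) u t hi fun k _ => hx k,
      show (toricHom K n Set.univ).toRingHom (x ⟨i + 1, by omega⟩) = _ from hx _, sub_self,
      zero_pow h0.ne', mul_zero]
  rintro _ ⟨i | i | i, rfl⟩
  · exact hv (i + 1) (by omega) (by omega) _ _ _ toricHom_univ_varX
  · exact hv (i + 1) (by omega) (by omega) _ _ _ toricHom_univ_varY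
  · change toricHom K n Set.univ (_ - _) = 0
    rw [map_sub, map_mul, map_mul, toricHom_univ_varX, toricHom_univ_varX, toricHom_univ_varY,
      toricHom_univ_varY, Fin.val_last, Fin.val_zero]
    ring

/-- Each prime `P` over the generators is the vanishing ideal of a point with coordinates in the
fraction field `L` of the quotient, so neither algebraic closedness nor the Nullstellensatz is
needed. -/
lemma scrollIdeal_le_radical (p : ℕ) [Fact p.Prime] [CharP K p] (h : ℕ) :
    scrollIdeal K (p ^ h) (p ^ h) ≤ (Ideal.span (Set.range (gens K (p ^ h)))).radical := by
  rw [Ideal.radical_eq_sInf]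
  refine le_sInf ?_
  rintro P ⟨hP, hprime⟩
  let L := FractionRing (MvPolynomial (Fin (p ^ h + 1) ⊕ Fin (p ^ h + 1)) K ⧸ P)
  let φ : MvPolynomial (Fin (p ^ h + 1) ⊕ Fin (p ^ h + 1)) K →+* L :=
    (algebraMap _ L).comp (Ideal.Quotient.mk P)
  have hφ : ∀ f, φ f = 0 ↔ f ∈ P := fun f => by
    rw [← Ideal.Quotient.eq_zero_iff_mem]
    exact map_eq_zero_iff _ (IsFractionRing.injective
      (MvPolynomial (Fin (p ^ h + 1) ⊕ Fin (p ^ h + 1)) K ⧸ P) L)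
  have : CharP L p := charP_of_injective_ringHom (φ.comp C).injective p
  have hz : ∀ i, φ (gens K (p ^ h) i) = 0 := fun i =>
    (hφ _).2 (hP (Ideal.subset_span (Set.mem_range_self i)))
  refine twoMinorsIdeal_le_iff.2 fun j k => ?_
  have key := minors_eq_zero p h (fun k => φ (varX K _ _ k)) (fun k => φ (varY K _ _ k))
    (fun i hi h0 => by
      obtain ⟨i, rfl⟩ := Nat.exists_eq_succ_of_ne_zero h0.ne'
      exact (map_verdi φ _ _ hi).symm.trans (hz (Sum.inl ⟨i, by omega⟩)))
    (fun i hi h0 => by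
      obtain ⟨i, rfl⟩ := Nat.exists_eq_succ_of_ne_zero h0.ne'
      exact (map_verdi φ _ _ hi).symm.trans (hz (Sum.inr (Sum.inl ⟨i, by omega⟩))))
    (by simpa [gens] using hz (Sum.inr (Sum.inr ()))) j k
  rw [← hφ, map_sub, map_mul, map_mul, sub_eq_zero]
  rcases j with j | j <;> rcases k with k | k <;> exact key

end ScrollIdeal

end Scroll

theorem mainTheorem3 {K : Type*} [Field K] (p : ℕ) (hp : p.Prime) [CharP K p]
    (h : ℕ) (hh : 0 < h) :
    Scroll.scrollIdeal K (p ^ h) (p ^ h) =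
        (Ideal.span (Set.range (Scroll.gens K (p ^ h)))).radical ∧
      Scroll.IsSetTheoreticCompleteIntersectionOn
        (Scroll.scrollIdeal K (p ^ h) (p ^ h)) (Scroll.gens K (p ^ h)) := by
  have : Fact p.Prime := ⟨hp⟩
  have hn : 1 < p ^ h := Nat.one_lt_pow hh.ne' hp.one_lt
  have hprime : (Scroll.scrollIdeal K (p ^ h) (p ^ h)).IsPrime := Scroll.scrollIdeal_isPrime
  have hrad : Scroll.scrollIdeal K (p ^ h) (p ^ h) =
      (Ideal.span (Set.range (Scroll.gens K (p ^ h)))).radical :=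
    (Scroll.scrollIdeal_le_radical p h).antisymm
      (hprime.radical_le_iff.2 Scroll.span_gens_le_scrollIdeal)
  have hcard : Fintype.card (Fin (p ^ h - 1) ⊕ Fin (p ^ h - 1) ⊕ Unit) = 2 * p ^ h - 1 := by
    simp only [Fintype.card_sum, Fintype.card_fin, Fintype.card_unit]
    omega
  refine ⟨hrad, by rw [← hrad, hprime.radical], le_antisymm ?_ ?_⟩
  · rw [hcard, Scroll.scrollIdeal_eq_ker]
    exact Scroll.le_height_ker_toricHom (by omega)
  -- A prime equal to the radical of the span is a minimal prime over it, so Krull's height theorem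
  -- applies.
  · have hmin : Scroll.scrollIdeal K (p ^ h) (p ^ h) ∈
        (Ideal.span (Set.range (Scroll.gens K (p ^ h)))).minimalPrimes :=
      ⟨⟨hprime, Scroll.span_gens_le_scrollIdeal⟩, fun J hJ _ =>
        hrad.le.trans (hJ.1.radical_le_iff.2 hJ.2)⟩
    refine (Ideal.height_le_card_of_mem_minimalPrimes_span (Set.finite_range _) hmin).trans ?_
    rw [← Nat.card_eq_fintype_card]
    exact_mod_cast Finite.card_range_le (Scroll.gens K (p ^ h))
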